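/- Let $G$ be a finite rooted tree with root $r$ and at most $T$ vertices, all of them at distance at most $n$ from $r$, where $T,n\ge 1$ are integers, and let some of the vertices other than the root be marked. Write $\ell(x)$ for the distance of $x$ from $r$, $x\to y$ if $y$ is a child of $x$, and $d_x$ for the degree of $x$ in the (undirected) tree. On the Hilbert space with orthonormal basis $\{|x\rangle : x \text{ a vertex}\}$ put $$|\psi_r\rangle=\frac1{\sqrt{1+d_r n}}\Big(|r\rangle+\sqrt n\sum_{r\to y}|y\rangle\Big),\qquad |\psi_x\rangle=\frac1{\sqrt{d_x}}\Big(|x\rangle+\sum_{x\to y}|y\rangle\Big)\quad(x\ne r).$$ Let $D_x$ act on $\mathcal H_x=\mathrm{span}(\{|x\rangle\}\cup\{|y\rangle:x\to y\})$ as the identity if $x$ is marked and as $I-2|\psi_x\rangle\langle\psi_x|$ otherwise. Let $$R_A=\bigoplus_{\ell(x)\text{ even}}D_x,\qquad R_B=|r\rangle\langle r|+\bigoplus_{\ell(x)\text{ odd}}D_x .$$ For constants $\beta,\gamma>0$ and $0<\delta<1$, the detection algorithm does the following. It repeats $K=\lceil\gamma\log(1/\delta)\rceil$ times, independently: apply phase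 estimation with precision $\beta/\sqrt{Tn}$ to $R_BR_A$, starting from $|r\rangle|0^s\rangle$, and accept if the measured eigenvalue is $1$. Here phase estimation is the standard circuit with $s$ ancilla qubits, $s\ge1$ being the least integer with $2^{-s}\le\beta/\sqrt{Tn}$: Hadamard gates on the ancilla qubits, then for each $j=0,\dots,s-1$ the operator $(R_BR_A)^{2^j}$ controlled by the $j$-th ancilla qubit, then the inverse quantum Fourier transform modulo $2^s$ and a measurement of the ancilla qubits; the outcome $0^s$ means eigenvalue $1$. The algorithm returns "marked vertex exists" if at least $3K/8$ of the repetitions accept, and "no marked vertex" otherwise. Then: 1. For all $\beta,\gamma>0$ the algorithm uses $R_A$ and $R_B$ (in controlled form) $O(\sqrt{Tn}\,\log(1/\delta))$ times each. Precisely, there is a constant $C$ depending only on $\beta,\gamma$ such that each of the two operators is used at most $C\sqrt{Tn}\,(1+\log(1/\delta))$ times for all $0<\delta<1$, and at most $C\sqrt{Tn}\,\log(1/\delta)$ times if $\delta\le 1/2$. 2. There are universal constants $\beta,\gamma>0$ such that, for all such trees, marked sets, $T$, $n$ and all $0<\delta<1$, the algorithm fails (that is, does not correctly report whether a marked vertex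 exists) with probability at most $\delta$. -/

import Mathlib

open scoped BigOperators

noncomputable section

namespace TreeWalk

section Walk

/-! ### The quantum walk on a rooted tree

The rooted tree is a (finite) tree `G` in the sense of graph theory with a distinguished root `r`;
`G.dist r x` is the distance of `x` from the root. The Hilbert space has the vertices as
orthonormal basis; vectors are functions `V → ℂ`, operators are matrices. -/

variable {V : Type*} [Fintype V]

/-- `x → y`: the vertex `y` is a child of `x` in the tree `G` rooted at `r`. -/
def IsChild (G : SimpleGraph V) (r x y : V) : Prop :=
  G.Adj x y ∧ G.dist r y = G.dist r x + 1

open Classical in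
/-- The set of children of `x`. -/
def children (G : SimpleGraph V) (r x : V) : Finset V :=
  Finset.univ.filter (fun y => IsChild G r x y)

open Classical in
/-- The basis vector `|x⟩`. -/
def ket (x : V) : V → ℂ := Pi.single x 1

/-- The rank-one operator `|v⟩⟨v|`. -/
def ketbra (v : V → ℂ) : Matrix V V ℂ := Matrix.vecMulVec v (star v)

open Classical in
/-- The states `|ψ_x⟩`: for `x ≠ r` it is `(|x⟩ + ∑_{x → y} |y⟩) / √d_x`, and for the root it is
`(|r⟩ + √n ∑_{r → y} |y⟩) / √(1 + d_r n)`. -/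
def psi (G : SimpleGraph V) (r : V) (n : ℕ) (x : V) : V → ℂ :=
  if x = r then
    ((1 / Real.sqrt (1 + (G.degree r : ℝ) * n) : ℝ) : ℂ) •
      (ket r + ((Real.sqrt n : ℝ) : ℂ) • ∑ y ∈ children G r r, ket y)
  else
    ((1 / Real.sqrt (G.degree x : ℝ) : ℝ) : ℂ) • (ket x + ∑ y ∈ children G r x, ket y)

open Classical in
/-- The identity of the subspace `H_x` spanned by `|x⟩` and the `|y⟩` with `x → y`, extended by zero
to the orthogonal complement. -/
def localOne (G : SimpleGraph V) (r x : V) : Matrix V V ℂ :=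
  Matrix.diagonal (fun y => if y = x ∨ IsChild G r x y then 1 else 0)

open Classical in
/-- The diffusion operator `D_x` on `H_x`, extended by zero to the orthogonal complement of `H_x`. -/
def diffusion (G : SimpleGraph V) (r : V) (marked : V → Prop) (n : ℕ) (x : V) : Matrix V V ℂ :=
  if marked x then localOne G r x
  else localOne G r x - (2 : ℂ) • ketbra (psi G r n x)

open Classical in
/-- `R_A = ⨁_{x ∈ A} D_x`, where `A` is the set of vertices at even distance from the root. (The sum
of the operators `D_x`, extended by zero, on the mutually orthogonal subspaces `H_x`.) -/
def opRA (G : SimpleGraph V) (r : V) (marked : V → Prop) (n : ℕ) : Matrix V V ℂ :=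
  ∑ x ∈ Finset.univ.filter (fun x => Even (G.dist r x)), diffusion G r marked n x

open Classical in
/-- `R_B = |r⟩⟨r| + ⨁_{x ∈ B} D_x`, where `B` is the set of vertices at odd distance from the
root. -/
def opRB (G : SimpleGraph V) (r : V) (marked : V → Prop) (n : ℕ) : Matrix V V ℂ :=
  ketbra (ket r) +
    ∑ x ∈ Finset.univ.filter (fun x => Odd (G.dist r x)), diffusion G r marked n x

end Walk

section Circuit

/-! ### Quantum circuits with access to two operators, and phase estimation -/

/-- Computational basis labels of a register of `s` qubits. -/
abbrev Register (s : ℕ) : Type := Fin s → Fin 2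

/-- The gates of a circuit on a work space and a register of `s` ancilla qubits: a fixed unitary
on the register, or one use of the operator `R_A` (or `R_B`) on the work space, controlled by the
`j`-th ancilla qubit. -/
inductive Gate (s : ℕ) : Type
  | ancilla (W : Matrix.unitaryGroup (Register s) ℂ) : Gate s
  | ctrlRA (j : Fin s) : Gate s
  | ctrlRB (j : Fin s) : Gate s

/-- `1` if the gate is a use of `R_A`, and `0` otherwise. -/
def Gate.costRA {s : ℕ} : Gate s → ℕ
  | .ancilla _ => 0
  | .ctrlRA _ => 1
  | .ctrlRB _ => 0

/-- `1` if the gate is a use of `R_B`, and `0` otherwise. -/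
def Gate.costRB {s : ℕ} : Gate s → ℕ
  | .ancilla _ => 0
  | .ctrlRA _ => 0
  | .ctrlRB _ => 1

/-- A circuit is a list of gates, applied from left to right. -/
abbrev Circuit (s : ℕ) : Type := List (Gate s)

/-- Number of uses of `R_A` in a circuit. -/
def Circuit.usesRA {s : ℕ} (c : Circuit s) : ℕ := (c.map Gate.costRA).sum

/-- Number of uses of `R_B` in a circuit. -/
def Circuit.usesRB {s : ℕ} (c : Circuit s) : ℕ := (c.map Gate.costRB).sum

variable {V : Type*} [Fintype V]

/-- The operator `M` on the work space, controlled by the `j`-th ancilla qubit. -/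
def controlled {s : ℕ} (M : Matrix V V ℂ) (j : Fin s) (φ : V × Register s → ℂ) :
    V × Register s → ℂ :=
  fun p => if p.2 j = 1 then ∑ y, M p.1 y * φ (y, p.2) else φ p

/-- The action of a gate on a joint state of the work space and the register. -/
def Gate.apply {s : ℕ} (RA RB : Matrix V V ℂ) (g : Gate s) (φ : V × Register s → ℂ) :
    V × Register s → ℂ :=
  match g with
  | .ancilla W => fun p => ∑ b, (W : Matrix (Register s) (Register s) ℂ) p.2 b * φ (p.1, b)
  | .ctrlRA j => controlled RA j φ
  | .ctrlRB j => controlled RB j φ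

/-- The action of a circuit. -/
def Circuit.run {s : ℕ} (RA RB : Matrix V V ℂ) (c : Circuit s) (φ : V × Register s → ℂ) :
    V × Register s → ℂ :=
  c.foldl (fun χ g => g.apply RA RB χ) φ

open Classical in
/-- The initial state `|x⟩|0^s⟩`. -/
def initState (s : ℕ) (x : V) : V × Register s → ℂ := Pi.single (x, 0) 1

/-- The probability that measuring the register of the joint state `φ` in the computational basis
gives the outcome `a`. -/
def bornProb {s : ℕ} (φ : V × Register s → ℂ) (a : Register s) : ℝ := ∑ x, ‖φ (x, a)‖ ^ 2

/-- The one-qubit Hadamard gate. -/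
def hadamard : Matrix (Fin 2) (Fin 2) ℂ :=
  ((1 / Real.sqrt 2 : ℝ) : ℂ) • !![1, 1; 1, -1]

/-- The Hadamard gate on each of the `s` qubits. -/
def hadamardAll (s : ℕ) : Matrix (Register s) (Register s) ℂ :=
  fun a b => ∏ j, hadamard (a j) (b j)

/-- The inverse quantum Fourier transform modulo `2 ^ s`; the basis label `a` stands for the number
`∑ j, a j * 2 ^ j`. -/
def invQFT (s : ℕ) : Matrix (Register s) (Register s) ℂ :=
  fun a b => ((1 / Real.sqrt (2 ^ s) : ℝ) : ℂ) *
    Complex.exp (-(2 * Real.pi * Complex.I *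
      ((finFunctionFinEquiv a : ℕ) : ℂ) * ((finFunctionFinEquiv b : ℕ) : ℂ) / (2 ^ s : ℂ)))

theorem hadamard_mul_star (a c : Fin 2) :
    ∑ b, hadamard a b * star (hadamard c b) = if a = c then 1 else 0 := by
  have h : ((Real.sqrt 2 : ℝ) : ℂ)⁻¹ * ((Real.sqrt 2 : ℝ) : ℂ)⁻¹ = 1 / 2 := by
    rw [← mul_inv, ← Complex.ofReal_mul, Real.mul_self_sqrt (by norm_num)]; norm_num
  fin_cases a <;> fin_cases c <;>
    simp [hadamard, Fin.sum_univ_two, h] <;> norm_num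

theorem hadamardAll_mem (s : ℕ) : hadamardAll s ∈ Matrix.unitaryGroup (Register s) ℂ := by
  rw [Matrix.mem_unitaryGroup_iff]
  ext a c
  have h := Finset.prod_univ_sum (fun _ : Fin s => (Finset.univ : Finset (Fin 2)))
    (fun j b => hadamard (a j) b * star (hadamard (c j) b))
  simp only [hadamard_mul_star, Fintype.piFinset_univ] at h
  simp only [Matrix.mul_apply, Matrix.star_apply, hadamardAll, star_prod,
    ← Finset.prod_mul_distrib, ← h, Matrix.one_apply, funext_iff]
  by_cases hac : ∀ j, a j = c j
  · simp [hac]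
  · rw [if_neg hac]
    push Not at hac
    obtain ⟨j, hj⟩ := hac
    exact Finset.prod_eq_zero (Finset.mem_univ j) (if_neg hj)

theorem invQFT_mem (s : ℕ) : invQFT s ∈ Matrix.unitaryGroup (Register s) ℂ := by
  rw [Matrix.mem_unitaryGroup_iff]
  ext a c
  have hN : (0 : ℝ) < 2 ^ s := by positivity
  have hNc : (2 ^ s : ℂ) ≠ 0 := pow_ne_zero _ two_ne_zero
  have hq : ((Real.sqrt (2 ^ s) : ℝ) : ℂ)⁻¹ * ((Real.sqrt (2 ^ s) : ℝ) : ℂ)⁻¹ =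
      ((2 : ℂ) ^ s)⁻¹ := by
    rw [← mul_inv, ← Complex.ofReal_mul, Real.mul_self_sqrt hN.le]; push_cast; rfl
  set z : ℂ := Complex.exp (2 * Real.pi * Complex.I *
    (((finFunctionFinEquiv c : ℕ) : ℂ) - ((finFunctionFinEquiv a : ℕ) : ℂ)) / (2 ^ s : ℂ)) with hz
  have hterm : ∀ b, invQFT s a b * star (invQFT s c b) =
      ((2 : ℂ) ^ s)⁻¹ * z ^ (finFunctionFinEquiv b : ℕ) := by
    intro b
    simp only [invQFT, one_div, Complex.ofReal_inv, Complex.star_def, map_mul, map_inv₀,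
      Complex.conj_ofReal, ← Complex.exp_conj, map_neg, map_div₀, map_pow, Complex.conj_I,
      map_natCast, map_ofNat]
    rw [mul_mul_mul_comm, hq, ← Complex.exp_add, hz, ← Complex.exp_nat_mul]
    congr 2
    ring
  simp only [Matrix.mul_apply, Matrix.star_apply, hterm, ← Finset.mul_sum]
  have hsum : ∑ b : Register s, z ^ (finFunctionFinEquiv b : ℕ) =
      ∑ k ∈ Finset.range (2 ^ s), z ^ k := by
    rw [← Fin.sum_univ_eq_sum_range]
    exact Equiv.sum_comp finFunctionFinEquiv (fun k : Fin (2 ^ s) => z ^ (k : ℕ))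
  rw [hsum, Matrix.one_apply]
  by_cases hac : a = c
  · subst hac
    have h1 : z = 1 := by simp [hz]
    simp [h1]
  · rw [if_neg hac]
    have hzN : z ^ (2 ^ s) = 1 := by
      rw [hz, ← Complex.exp_nat_mul, Complex.exp_eq_one_iff]
      refine ⟨(finFunctionFinEquiv c : ℕ) - (finFunctionFinEquiv a : ℕ), ?_⟩
      push_cast
      field_simp
    have hz1 : z ≠ 1 := by
      intro h
      rw [hz, Complex.exp_eq_one_iff] at h
      obtain ⟨m, hm⟩ := h
      have hpi : (2 * Real.pi * Complex.I : ℂ) ≠ 0 := Complex.two_pi_I_ne_zero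
      have h2 : (((finFunctionFinEquiv c : ℕ) : ℂ) - ((finFunctionFinEquiv a : ℕ) : ℂ)) =
          m * (2 ^ s : ℂ) := by
        rw [div_eq_iff hNc] at hm
        apply mul_left_cancel₀ hpi
        rw [hm]; ring
      have h3 : ((finFunctionFinEquiv c : ℕ) : ℤ) - ((finFunctionFinEquiv a : ℕ) : ℤ) =
          m * ((2 ^ s : ℕ) : ℤ) := by
        exact_mod_cast h2
      have hla := (finFunctionFinEquiv a).isLt
      have hlc := (finFunctionFinEquiv c).isLt
      have h4 : ((2 ^ s : ℕ) : ℤ) ∣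
          ((finFunctionFinEquiv c : ℕ) : ℤ) - ((finFunctionFinEquiv a : ℕ) : ℤ) :=
        ⟨m, by rw [h3, mul_comm]⟩
      have h5 := Int.eq_zero_of_abs_lt_dvd h4 (by rw [abs_lt]; omega)
      apply hac
      apply finFunctionFinEquiv.injective
      apply Fin.ext
      omega
    have hg := geom_sum_mul z (2 ^ s)
    rw [hzN, sub_self] at hg
    rcases mul_eq_zero.1 hg with h | h
    · rw [h, mul_zero]
    · exact absurd (sub_eq_zero.1 h) hz1

/-- The phase estimation circuit for the operator `R_B R_A` on `s` ancilla qubits: Hadamard gates,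
then for each `j` the operator `(R_B R_A) ^ (2 ^ j)` controlled by the `j`-th ancilla qubit, then the
inverse quantum Fourier transform. -/
def phaseEstimation (s : ℕ) : Circuit s :=
  [Gate.ancilla ⟨hadamardAll s, hadamardAll_mem s⟩] ++
    (List.finRange s).flatMap
      (fun j : Fin s => (List.replicate (2 ^ (j : ℕ)) [Gate.ctrlRA j, Gate.ctrlRB j]).flatten) ++
    [Gate.ancilla ⟨invQFT s, invQFT_mem s⟩]

end Circuit

section Algorithm

/-! ### The detection algorithm -/

/-- The number `s` of ancilla qubits of phase estimation with precision `ε`: the least `s ≥ 1` with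
`2 ^ (-s) ≤ ε`. -/
def precisionBits (ε : ℝ) : ℕ := max 1 ⌈Real.logb 2 (1 / ε)⌉₊

/-- The number of ancilla qubits for precision `β / √(T n)`. -/
def detectBits (β : ℝ) (T n : ℕ) : ℕ := precisionBits (β / Real.sqrt ((T : ℝ) * n))

/-- The number `K = ⌈γ log (1 / δ)⌉` of repetitions. -/
def detectReps (γ δ : ℝ) : ℕ := ⌈γ * Real.log (1 / δ)⌉₊

/-- The total number of uses of `R_A` by the algorithm. -/
def detectUsesRA (β γ : ℝ) (T n : ℕ) (δ : ℝ) : ℕ :=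
  detectReps γ δ * (phaseEstimation (detectBits β T n)).usesRA

/-- The total number of uses of `R_B` by the algorithm. -/
def detectUsesRB (β γ : ℝ) (T n : ℕ) (δ : ℝ) : ℕ :=
  detectReps γ δ * (phaseEstimation (detectBits β T n)).usesRB

variable {V : Type*} [Fintype V]

/-- The distribution of the measurement outcome of a single phase estimation, started in the
state `|r⟩|0^s⟩`. The outcome `0^s` means that the eigenvalue is `1`. -/
def runProb (RA RB : Matrix V V ℂ) (r : V) (s : ℕ) (a : Register s) : ℝ :=
  bornProb ((phaseEstimation s).run RA RB (initState s r)) a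

/-- The classical output of the algorithm on the outcomes of the `K` repetitions: `true`
("marked vertex exists") if at least `3 K / 8` of them accept, i.e. have outcome `0^s`, and `false`
("no marked vertex") otherwise. -/
def decision {K s : ℕ} (o : Fin K → Register s) : Bool :=
  decide (3 * K ≤ 8 * (Finset.univ.filter (fun i => o i = 0)).card)

/-- The probability that the algorithm with operators `R_A`, `R_B`, started at `r`, returns `b`; the
`K` repetitions are independent. -/
def outputProb (RA RB : Matrix V V ℂ) (r : V) (β γ : ℝ) (T n : ℕ) (δ : ℝ) (b : Bool) : ℝ :=
  ∑ o ∈ Finset.univ.filter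
      (fun o : Fin (detectReps γ δ) → Register (detectBits β T n) => decision o = b),
    ∏ i, runProb RA RB r (detectBits β T n) (o i)

end Algorithm

end TreeWalk

end

/-! Write `U = R_B R_A` and `N = 2 ^ s`. A run accepts with probability `‖(1/N) ∑_{k<N} U^k |r⟩‖²`
(`runProb_zero`), so no spectral decomposition is needed: a fixed vector of `U` bounds this from
below, and writing `|r⟩` as `(1 - U)` of something short bounds it from above.

If `x₀` is marked, put alternating signs on the path from `r` to `x₀` and enlarge the root entry to
`√n` (`exists_fixed_vector`). This is orthogonal to every unmarked `ψ_x`, hence fixed by both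
reflections. Its squared norm is at most `2n` and its squared root entry is `n`, so acceptance is at
least `1/2` (`le_runProb_zero`).

If nothing is marked, let `η` be `potential r n`. Then `R_A η = -η` and `R_B η = 2|r⟩ - η`, so `2|r⟩
= η - U η`. The average telescopes to `(η - U^N η) / (2N)`, and acceptance is at most `‖η‖² / N² ≤ T
n / N²` (`runProb_zero_le`). With `β = 1/2` one has `N ≥ 2√(Tn)`, giving at most `1/4`.

The threshold `3/8` separates these two cases, and exponential Markov bounds (`lower_tail`,
`upper_tail`) turn the gap into error at most `(49/50)^K ≤ δ`. The query count is the geometric sum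
`∑ 2^j = 2^s - 1` times `K`. -/

namespace TreeWalk

/-! ### Parents, children and levels in a rooted tree -/

section Tree

variable {V : Type*} {G : SimpleGraph V} {r x y z : V}

/-- The child relation only holds for adjacent vertices, hence is irreflexive. -/
theorem IsChild.ne (h : IsChild G r x y) : y ≠ x := h.1.ne'

theorem IsChild.ne_root (h : IsChild G r x y) : y ≠ r := by
  rintro rfl
  have := h.2
  simp at this

/-- A geodesic to a parent, prolonged by the edge to the child, is again a geodesic and hence a
path. Paths in a tree are unique, so their penultimate vertices agree. -/
theorem IsChild.parent_unique (hG : G.IsTree) (hx : IsChild G r x z) (hy : IsChild G r y z) :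
    x = y := by
  have key : ∀ {w : V}, IsChild G r w z → ∃ p : G.Walk r z, p.IsPath ∧ p.penultimate = w := by
    intro w hw
    obtain ⟨p, hp⟩ := hG.connected.exists_walk_length_eq_dist r w
    refine ⟨p.concat hw.1, SimpleGraph.Walk.isPath_of_length_eq_dist _ ?_, by simp⟩
    rw [SimpleGraph.Walk.length_concat, hp, hw.2]
  obtain ⟨p, hp, rfl⟩ := key hx
  obtain ⟨q, hq, rfl⟩ := key hy
  rw [(hG.existsUnique_path r z).unique hp hq]

theorem exists_parent (hG : G.IsTree) (hy : y ≠ r) : ∃ x, IsChild G r x y := by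
  obtain ⟨p, hp⟩ := hG.connected.exists_walk_length_eq_dist y r
  cases p with
  | nil => exact absurd rfl hy
  | cons h q =>
    refine ⟨_, h.symm, ?_⟩
    rw [SimpleGraph.Walk.length_cons] at hp
    rcases hG.dist_eq_dist_add_one_of_adj r h with h1 | h1
    · exact h1
    · have := SimpleGraph.dist_le q
      rw [SimpleGraph.dist_comm] at this hp
      omega

/-- A vertex lies in at most one of the spaces `H_x` with `x` on levels of a given parity. -/
theorem owner_unique (hG : G.IsTree) (hpar : Even (G.dist r x) ↔ Even (G.dist r y))
    (hx : z = x ∨ IsChild G r x z) (hy : z = y ∨ IsChild G r y z) : x = y := by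
  rcases hx with rfl | hx <;> rcases hy with rfl | hy
  · rfl
  · rw [hy.2, Nat.even_add_one] at hpar
    tauto
  · rw [hx.2, Nat.even_add_one] at hpar
    tauto
  · exact hx.parent_unique hG hy

theorem exists_even_owner (hG : G.IsTree) (y : V) :
    ∃ x, Even (G.dist r x) ∧ (y = x ∨ IsChild G r x y) := by
  by_cases hy : Even (G.dist r y)
  · exact ⟨y, hy, Or.inl rfl⟩
  · have hyr : y ≠ r := by
      rintro rfl
      simp at hy
    obtain ⟨x, hx⟩ := exists_parent hG hyr
    rw [hx.2, Nat.even_add_one, not_not] at hy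
    exact ⟨x, hy, Or.inr hx⟩

/-- The spaces `H_x` on odd levels cover every basis vector except the root; this gap is what the
term `|r⟩⟨r|` in `R_B` fills. -/
theorem exists_odd_owner (hG : G.IsTree) {y : V} (hyr : y ≠ r) :
    ∃ x, Odd (G.dist r x) ∧ (y = x ∨ IsChild G r x y) := by
  by_cases hy : Odd (G.dist r y)
  · exact ⟨y, hy, Or.inl rfl⟩
  · obtain ⟨x, hx⟩ := exists_parent hG hyr
    rw [hx.2, Nat.odd_add_one, not_not] at hy
    exact ⟨x, hy, Or.inr hx⟩

theorem not_odd_owner_root {x : V} (hx : Odd (G.dist r x)) : ¬ (r = x ∨ IsChild G r x r) := by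
  rintro (rfl | h)
  · simp at hx
  · exact h.ne_root rfl

variable [Fintype V]

theorem mem_children : y ∈ children G r x ↔ IsChild G r x y := by
  simp [children]

open Classical in
theorem card_children_root : (children G r r).card = G.degree r := by
  rw [← SimpleGraph.card_neighborFinset_eq_degree]
  congr 1
  ext y
  rw [mem_children, SimpleGraph.mem_neighborFinset]
  refine ⟨fun h => h.1, fun h => ⟨h, ?_⟩⟩
  rw [SimpleGraph.dist_self, SimpleGraph.dist_eq_one_iff_adj.2 h]

open Classical in
theorem card_children_add_one (hG : G.IsTree) (hx : x ≠ r) :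
    (children G r x).card + 1 = G.degree x := by
  obtain ⟨w, hw⟩ := exists_parent hG hx
  have hwn : w ∉ children G r x := by
    rw [mem_children]
    intro h
    have h1 := h.2
    have h2 := hw.2
    omega
  rw [← SimpleGraph.card_neighborFinset_eq_degree, ← Finset.card_insert_of_notMem hwn]
  congr 1
  ext y
  rw [Finset.mem_insert, mem_children, SimpleGraph.mem_neighborFinset]
  constructor
  · rintro (rfl | h)
    · exact hw.1.symm
    · exact h.1
  · intro h
    rcases hG.dist_eq_dist_add_one_of_adj r h with h1 | h1
    · exact Or.inl (IsChild.parent_unique hG ⟨h.symm, h1⟩ hw)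
    · exact Or.inr ⟨h, h1⟩

/-- Alternating signs along the path from the root to `x`. -/
theorem exists_path_signs (hG : G.IsTree) (x : V) :
    ∃ f : V → ℝ, f r = 1 ∧ f x = (-1) ^ G.dist r x ∧ (∀ y, G.dist r x < G.dist r y → f y = 0) ∧
      (∀ y, y ≠ x → f y + ∑ z ∈ children G r y, f z = 0) ∧ ∑ y, f y ^ 2 = G.dist r x + 1 := by
  classical
  induction hk : G.dist r x generalizing x with
  | zero =>
    have hrx : r = x := hG.connected.dist_eq_zero_iff.1 hk
    subst hrx
    refine ⟨Pi.single r 1, by simp, by simp, ?_, ?_, ?_⟩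
    · intro y hy
      rw [Pi.single_eq_of_ne]
      rintro rfl
      simp at hy
    · intro y hy
      rw [Pi.single_eq_of_ne hy, zero_add]
      refine Finset.sum_eq_zero fun z hz => ?_
      rw [Pi.single_eq_of_ne (mem_children.1 hz).ne_root]
    · simp [Pi.single_apply]
  | succ k ih =>
    have hxr : x ≠ r := by
      rintro rfl
      simp at hk
    obtain ⟨w, hw⟩ := exists_parent hG hxr
    have hwk : G.dist r w = k := by
      have := hw.2
      omega
    obtain ⟨f, h1, h2, h3, h4, h5⟩ := ih w hwk
    have hfx : f x = 0 := h3 x (by omega)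
    -- The path is extended by its next vertex `x`. Since `f` vanishes below level `k`, the old
    -- value at `x` is zero and the sum of squares grows by one.
    refine ⟨Function.update f x ((-1) ^ (k + 1)), ?_, by simp, ?_, ?_, ?_⟩
    · rw [Function.update_of_ne hxr.symm, h1]
    · intro y hy
      rw [Function.update_of_ne, h3 y (by omega)]
      rintro rfl
      omega
    · intro y hy
      rw [Function.update_of_ne hy]
      -- Only the balance at the parent `w` changes. The induction hypothesis exempts `w`, and its
      -- value is now cancelled by the opposite sign at `x`.
      by_cases hyw : y = w
      · subst hyw
        rw [Finset.sum_eq_single_of_mem x (mem_children.2 hw)]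
        · rw [h2, Function.update_self]
          ring
        · intro z hz hzx
          rw [Function.update_of_ne hzx]
          have := (mem_children.1 hz).2
          exact h3 z (by omega)
      · rw [← h4 y hyw]
        congr 1
        refine Finset.sum_congr rfl fun z hz => ?_
        rw [Function.update_of_ne]
        rintro rfl
        exact hyw ((mem_children.1 hz).parent_unique hG hw)
    · have : ∀ y, Function.update f x ((-1) ^ (k + 1)) y ^ 2 =
          f y ^ 2 + if y = x then 1 else 0 := by
        intro y
        by_cases hy : y = x
        · subst hy
          simp [hfx, ← pow_mul, mul_comm _ 2]
        · simp [hy]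
      simp only [this, Finset.sum_add_distrib, h5]
      simp

end Tree

/-! ### Basis vectors -/

section Ket

variable {V : Type*} {x y : V}

theorem ket_self : (ket x : V → ℂ) x = 1 := by
  simp [ket]

theorem ket_of_ne (h : y ≠ x) : (ket x : V → ℂ) y = 0 := by
  simp [ket, h]

theorem sum_ket_apply_of_mem {s : Finset V} (h : y ∈ s) : ∑ z ∈ s, (ket z : V → ℂ) y = 1 := by
  rw [Finset.sum_eq_single_of_mem y h fun z _ hz => ket_of_ne hz.symm, ket_self]

theorem sum_ket_apply_of_notMem {s : Finset V} (h : y ∉ s) :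
    ∑ z ∈ s, (ket z : V → ℂ) y = 0 :=
  Finset.sum_eq_zero fun _ hz => ket_of_ne fun hzy => h (hzy ▸ hz)

end Ket

/-! ### Amplitudes and orthonormality of the states `ψ_x` -/

section States

variable {V : Type*} [Fintype V] {G : SimpleGraph V} {r : V} {n : ℕ} {x y : V}

open Classical in
/-- The amplitude of `|ψ_x⟩` at `x`. -/
noncomputable def ampSelf (G : SimpleGraph V) (r : V) (n : ℕ) (x : V) : ℝ :=
  if x = r then 1 / Real.sqrt (1 + (G.degree r : ℝ) * n) else 1 / Real.sqrt (G.degree x : ℝ)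

open Classical in
/-- The amplitude of `|ψ_x⟩` at the children of `x`. -/
noncomputable def ampChild (G : SimpleGraph V) (r : V) (n : ℕ) (x : V) : ℝ :=
  if x = r then ampSelf G r n x * Real.sqrt n else ampSelf G r n x

theorem psi_self : psi G r n x x = ampSelf G r n x := by
  have hs := sum_ket_apply_of_notMem fun h : x ∈ children G r x => (mem_children.1 h).ne rfl
  unfold psi ampSelf
  split_ifs with hx
  · subst hx
    simp [Finset.sum_apply, hs, ket_self]
  · simp [Finset.sum_apply, hs, ket_self]

theorem psi_child (h : IsChild G r x y) : psi G r n x y = ampChild G r n x := by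
  have hs := sum_ket_apply_of_mem (mem_children.2 h)
  unfold psi ampChild ampSelf
  split_ifs with hx
  · subst hx
    simp [Finset.sum_apply, hs, ket_of_ne h.ne]
  · simp [Finset.sum_apply, hs, ket_of_ne h.ne]

theorem psi_eq_zero (h : ¬ (y = x ∨ IsChild G r x y)) : psi G r n x y = 0 := by
  push Not at h
  have hs := sum_ket_apply_of_notMem fun h' : y ∈ children G r x => h.2 (mem_children.1 h')
  unfold psi
  split_ifs with hx
  · subst hx
    simp [Finset.sum_apply, hs, ket_of_ne h.1]
  · simp [Finset.sum_apply, hs, ket_of_ne h.1]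

theorem amp_sq (hG : G.IsTree) :
    ampSelf G r n x ^ 2 + ampChild G r n x ^ 2 * (children G r x).card = 1 := by
  classical
  by_cases hx : x = r
  · subst hx
    rw [card_children_root]
    simp only [ampChild, ampSelf, if_true, mul_pow, div_pow, one_pow]
    rw [Real.sq_sqrt (by positivity), Real.sq_sqrt (by positivity)]
    field_simp
  · have h := card_children_add_one hG hx
    have h' : (G.degree x : ℝ) = (children G r x).card + 1 := by
      rw [← h]
      push_cast
      rfl
    simp only [ampChild, ampSelf, if_neg hx, div_pow, one_pow]
    rw [h', Real.sq_sqrt (by positivity)]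
    field_simp
    ring

open Matrix in
theorem psi_dotProduct (v : V → ℂ) :
    star (psi G r n x) ⬝ᵥ v = ampSelf G r n x * v x +
      ampChild G r n x * ∑ y ∈ children G r x, v y := by
  classical
  have hx : x ∉ children G r x := fun h => (mem_children.1 h).ne rfl
  rw [dotProduct, ← Finset.sum_subset (Finset.subset_univ (insert x (children G r x))),
    Finset.sum_insert hx]
  · rw [Finset.mul_sum]
    congr 1
    · simp [psi_self]
    · refine Finset.sum_congr rfl fun y hy => ?_
      simp [psi_child (mem_children.1 hy)]
  · intro y _ hy
    rw [Finset.mem_insert, mem_children] at hy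
    simp [psi_eq_zero hy]

open Matrix in
theorem psi_norm (hG : G.IsTree) : star (psi G r n x) ⬝ᵥ psi G r n x = 1 := by
  rw [psi_dotProduct, psi_self, Finset.sum_congr rfl fun y hy => psi_child (mem_children.1 hy),
    Finset.sum_const, nsmul_eq_mul]
  have h := amp_sq (r := r) (n := n) (x := x) hG
  have h' : ((ampSelf G r n x ^ 2 + ampChild G r n x ^ 2 * (children G r x).card : ℝ) : ℂ) = 1 := by
    rw [h]
    simp
  rw [← h']
  push_cast
  ring

-- On levels of equal parity the supports are disjoint, by `owner_unique`.
open Matrix in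
theorem psi_orthogonal (hG : G.IsTree) (hxy : x ≠ y)
    (hpar : Even (G.dist r x) ↔ Even (G.dist r y)) :
    star (psi G r n x) ⬝ᵥ psi G r n y = 0 := by
  refine Finset.sum_eq_zero fun z _ => ?_
  by_cases hx : z = x ∨ IsChild G r x z
  · by_cases hy : z = y ∨ IsChild G r y z
    · exact absurd (owner_unique hG hpar hx hy) hxy
    · rw [psi_eq_zero hy, mul_zero]
  · rw [Pi.star_apply, psi_eq_zero hx, star_zero, zero_mul]

end States

/-! ### Reflections built from orthonormal families -/

section Reflections

open Matrix

variable {V : Type*}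

theorem ketbra_isHermitian (v : V → ℂ) : (ketbra v).IsHermitian := by
  rw [IsHermitian, ketbra, conjTranspose_vecMulVec, star_star]

theorem reflection_isHermitian [DecidableEq V] (S : Finset V) (ψ : V → V → ℂ) :
    (1 - (2 : ℂ) • ∑ x ∈ S, ketbra (ψ x)).IsHermitian := by
  rw [IsHermitian, conjTranspose_sub, conjTranspose_one, conjTranspose_smul, conjTranspose_sum]
  simp only [(ketbra_isHermitian _).eq, star_ofNat]

variable [Fintype V]

theorem ketbra_mulVec (v w : V → ℂ) : ketbra v *ᵥ w = (star v ⬝ᵥ w) • v := by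
  rw [ketbra, vecMulVec_mulVec, op_smul_eq_smul]

theorem ketbra_mul_ketbra (v w : V → ℂ) :
    ketbra v * ketbra w = (star v ⬝ᵥ w) • vecMulVec v (star w) := by
  simp only [ketbra, vecMulVec_mul_vecMulVec]
  ext i j
  simp [vecMulVec_apply]
  ring

/-- The reflection about the orthogonal complement of the span of the vectors `ψ x`, `x ∈ S`. -/
theorem reflection_sq [DecidableEq V] {S : Finset V} {ψ : V → V → ℂ}
    (h1 : ∀ x ∈ S, star (ψ x) ⬝ᵥ ψ x = 1)
    (h2 : ∀ x ∈ S, ∀ y ∈ S, x ≠ y → star (ψ x) ⬝ᵥ ψ y = 0) :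
    (1 - (2 : ℂ) • ∑ x ∈ S, ketbra (ψ x)) * (1 - (2 : ℂ) • ∑ x ∈ S, ketbra (ψ x)) = 1 := by
  have hP : (∑ x ∈ S, ketbra (ψ x)) * (∑ x ∈ S, ketbra (ψ x)) = ∑ x ∈ S, ketbra (ψ x) := by
    rw [Finset.sum_mul]
    refine Finset.sum_congr rfl fun x hx => ?_
    rw [Finset.mul_sum, Finset.sum_eq_single_of_mem x hx, ketbra_mul_ketbra, h1 x hx, one_smul,
      ketbra]
    intro y hy hyx
    rw [ketbra_mul_ketbra, h2 x hx y hy hyx.symm, zero_smul]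
  rw [sub_mul, mul_sub, mul_sub, smul_mul_smul_comm, hP]
  simp only [one_mul, mul_one, ← sub_smul, sub_sub]
  module

theorem reflection_mulVec [DecidableEq V] (S : Finset V) (ψ : V → V → ℂ) (v : V → ℂ) :
    (1 - (2 : ℂ) • ∑ x ∈ S, ketbra (ψ x)) *ᵥ v =
      v - (2 : ℂ) • ∑ x ∈ S, (star (ψ x) ⬝ᵥ v) • ψ x := by
  simp only [sub_mulVec, one_mulVec, smul_mulVec, sum_mulVec, ketbra_mulVec]

end Reflections

/-! ### The walk operators and the two test vectors -/

section Operators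

open Matrix

variable {V : Type*} [Fintype V] {G : SimpleGraph V} {r : V} {marked : V → Prop} {n : ℕ}

open Classical in
theorem sum_diffusion (S : Finset V) :
    ∑ x ∈ S, diffusion G r marked n x = ∑ x ∈ S, localOne G r x -
      (2 : ℂ) • ∑ x ∈ S.filter (fun x => ¬ marked x), ketbra (psi G r n x) := by
  rw [Finset.smul_sum, Finset.sum_filter, ← Finset.sum_sub_distrib]
  refine Finset.sum_congr rfl fun x _ => ?_
  unfold diffusion
  split_ifs <;> simp_all

-- Each basis vector lies in exactly one `H_x` with `x` on an even level, so the local identities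
-- add up to `1`; marking `x` merely drops its projection.
open Classical in
theorem opRA_eq (hG : G.IsTree) : opRA G r marked n = 1 - (2 : ℂ) •
    ∑ x ∈ (Finset.univ.filter fun x => Even (G.dist r x)).filter (fun x => ¬ marked x),
      ketbra (psi G r n x) := by
  rw [opRA, sum_diffusion]
  congr 1
  simp only [localOne]
  ext y z
  rw [Matrix.sum_apply]
  by_cases hyz : y = z
  · subst hyz
    obtain ⟨x, hx, hxy⟩ := exists_even_owner (r := r) hG y
    rw [Finset.sum_eq_single_of_mem x (by simpa using hx)]
    · simp [hxy]
    · intro w hw hwx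
      rw [diagonal_apply_eq, if_neg]
      intro hwy
      exact hwx (owner_unique hG (by simp_all) hwy hxy)
  · simp [hyz]

open Classical in
theorem opRB_eq (hG : G.IsTree) : opRB G r marked n = 1 - (2 : ℂ) •
    ∑ x ∈ (Finset.univ.filter fun x => Odd (G.dist r x)).filter (fun x => ¬ marked x),
      ketbra (psi G r n x) := by
  rw [opRB, sum_diffusion, ← add_sub_assoc]
  congr 1
  simp only [localOne]
  ext y z
  rw [Matrix.add_apply, Matrix.sum_apply]
  by_cases hyz : y = z
  · subst hyz
    by_cases hyr : y = r
    · subst hyr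
      rw [Finset.sum_eq_zero]
      · simp [ketbra, vecMulVec_apply, ket_self]
      · intro w hw
        rw [diagonal_apply_eq, if_neg (not_odd_owner_root (by simpa using hw))]
    obtain ⟨x, hx, hxy⟩ := exists_odd_owner (r := r) hG hyr
    rw [Finset.sum_eq_single_of_mem x (by simpa using hx)]
    · simp [hxy, ketbra, vecMulVec_apply, ket_of_ne hyr]
    · intro w hw hwx
      rw [diagonal_apply_eq, if_neg]
      intro hwy
      exact hwx (owner_unique hG (by simp_all [← Nat.not_even_iff_odd]) hwy hxy)
  · have : ketbra (ket r) y z = 0 := by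
      by_cases hyr : y = r
      · have : z ≠ r := fun h => hyz (hyr.trans h.symm)
        simp [ketbra, vecMulVec_apply, ket_of_ne this]
      · simp [ketbra, vecMulVec_apply, ket_of_ne hyr]
    simp [hyz, this]

open Classical in
theorem opRA_sq (hG : G.IsTree) : opRA G r marked n * opRA G r marked n = 1 := by
  rw [opRA_eq hG]
  refine reflection_sq (fun x _ => psi_norm hG) fun x hx y hy hxy => ?_
  simp only [Finset.mem_filter, Finset.mem_univ, true_and] at hx hy
  exact psi_orthogonal hG hxy (by simp [hx.1, hy.1])

open Classical in
theorem opRB_sq (hG : G.IsTree) : opRB G r marked n * opRB G r marked n = 1 := by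
  rw [opRB_eq hG]
  refine reflection_sq (fun x _ => psi_norm hG) fun x hx y hy hxy => ?_
  simp only [Finset.mem_filter, Finset.mem_univ, true_and, ← Nat.not_even_iff_odd] at hx hy
  exact psi_orthogonal hG hxy (by simp [hx.1, hy.1])

theorem opRA_isHermitian (hG : G.IsTree) : (opRA G r marked n).IsHermitian := by
  classical
  rw [opRA_eq hG]
  exact reflection_isHermitian _ _

theorem opRB_isHermitian (hG : G.IsTree) : (opRB G r marked n).IsHermitian := by
  classical
  rw [opRB_eq hG]
  exact reflection_isHermitian _ _

/-- A vector orthogonal to all `|ψ_x⟩` with `x` unmarked is fixed by `R_A` and `R_B`. -/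
theorem walk_mulVec_of_orthogonal (hG : G.IsTree) {v : V → ℂ}
    (hv : ∀ x, ¬ marked x → star (psi G r n x) ⬝ᵥ v = 0) :
    opRA G r marked n *ᵥ v = v ∧ opRB G r marked n *ᵥ v = v := by
  classical
  rw [opRA_eq hG, opRB_eq hG, reflection_mulVec, reflection_mulVec,
    Finset.sum_eq_zero, Finset.sum_eq_zero]
  · simp
  all_goals
    intro x hx
    rw [hv x (Finset.mem_filter.1 hx).2, zero_smul]

/-- The signed path to `x₀` is balanced at every vertex but `x₀`, whose reflection is absent because
it is marked. Its squared norm after rescaling the root is `n + ℓ(x₀)`. -/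
theorem exists_fixed_vector (hG : G.IsTree) (hd : ∀ x, G.dist r x ≤ n)
    {x₀ : V} (hx₀ : marked x₀) (hr : ¬ marked r) :
    ∃ φ : V → ℂ, opRA G r marked n *ᵥ φ = φ ∧ opRB G r marked n *ᵥ φ = φ ∧
      φ r = (Real.sqrt n : ℝ) ∧ ∑ x, ‖φ x‖ ^ 2 ≤ 2 * n := by
  classical
  obtain ⟨f, h1, -, -, h4, h5⟩ := exists_path_signs (r := r) hG x₀
  have hf : ∀ y, y ≠ x₀ → (f y : ℂ) + ∑ z ∈ children G r y, (f z : ℂ) = 0 := by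
    intro y hy
    exact_mod_cast congrArg (fun t : ℝ => (t : ℂ)) (h4 y hy)
  have hφ : ∀ x, ¬ marked x → star (psi G r n x) ⬝ᵥ
      (fun y => (((if y = r then Real.sqrt n else 1) * f y : ℝ) : ℂ)) = 0 := by
    intro x hx
    rw [psi_dotProduct]
    have hx' : x ≠ x₀ := by
      rintro rfl
      exact hx hx₀
    have hs : ∑ y ∈ children G r x, (((if y = r then Real.sqrt n else 1) * f y : ℝ) : ℂ) =
        ∑ y ∈ children G r x, (f y : ℂ) := by
      refine Finset.sum_congr rfl fun y hy => ?_
      rw [if_neg (mem_children.1 hy).ne_root, one_mul]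
    rw [hs, eq_neg_of_add_eq_zero_right (hf x hx')]
    -- In `ψ_r` the children carry `√n` times the root's amplitude; the entry `√n` of the vector at
    -- the root compensates exactly this.
    unfold ampChild
    split_ifs
    · push_cast
      ring
    · push_cast
      ring
  obtain ⟨hA, hB⟩ := walk_mulVec_of_orthogonal hG hφ
  refine ⟨_, hA, hB, by simp [h1], ?_⟩
  have hterm : ∀ y, ‖(((if y = r then Real.sqrt n else 1) * f y : ℝ) : ℂ)‖ ^ 2 =
      f y ^ 2 + if y = r then (n : ℝ) - 1 else 0 := by
    intro y
    rw [Complex.norm_real, Real.norm_eq_abs, sq_abs]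
    by_cases hy : y = r
    · subst hy
      simp [h1]
    · simp [hy]
  simp only [hterm, Finset.sum_add_distrib, h5]
  have : (G.dist r x₀ : ℝ) ≤ n := by exact_mod_cast hd x₀
  simp
  linarith

open Classical in
/-- The vector `|r⟩ + √n ∑_{x ≠ r} |x⟩`. -/
noncomputable def potential (r : V) (n : ℕ) : V → ℂ :=
  fun x => if x = r then 1 else ((Real.sqrt n : ℝ) : ℂ)

/-- On `H_x` the vector `potential r n` is a multiple of the unit vector `ψ_x` (ratio `1 : √n` at
the root, constant elsewhere), so projecting onto `ψ_x` gives it back. -/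
theorem psi_dotProduct_potential (hG : G.IsTree) {x y : V} (hy : y = x ∨ IsChild G r x y) :
    (star (psi G r n x) ⬝ᵥ potential r n) * psi G r n x y = potential r n y := by
  classical
  have hs : ∑ z ∈ children G r x, potential r n z =
      (children G r x).card * ((Real.sqrt n : ℝ) : ℂ) := by
    rw [← nsmul_eq_mul, ← Finset.sum_const]
    refine Finset.sum_congr rfl fun z hz => ?_
    rw [potential, if_neg (mem_children.1 hz).ne_root]
  -- This is the proportionality of the two vectors, in cross-multiplied form.
  have hamp : (ampChild G r n x : ℂ) * potential r n x =
      ampSelf G r n x * ((Real.sqrt n : ℝ) : ℂ) := by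
    unfold ampChild potential
    split_ifs <;> simp
  have h1 : (ampSelf G r n x : ℂ) ^ 2 + (ampChild G r n x : ℂ) ^ 2 * (children G r x).card = 1 := by
    exact_mod_cast congrArg (fun t : ℝ => (t : ℂ)) (amp_sq (r := r) (n := n) (x := x) hG)
  rw [psi_dotProduct, hs]
  rcases hy with rfl | hy
  · rw [psi_self]
    linear_combination (potential r n y) * h1 -
      (ampChild G r n y) * (children G r y).card * hamp
  · rw [psi_child hy]
    have : potential r n y = ((Real.sqrt n : ℝ) : ℂ) := by
      rw [potential, if_neg hy.ne_root]
    rw [this]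
    linear_combination ((Real.sqrt n : ℝ) : ℂ) * h1 + (ampSelf G r n x : ℂ) * hamp

theorem sum_psi_potential (hG : G.IsTree) {S : Finset V} {x y : V} (hx : x ∈ S)
    (hxy : y = x ∨ IsChild G r x y)
    (hS : ∀ w ∈ S, Even (G.dist r w) ↔ Even (G.dist r x)) :
    (∑ x ∈ S, (star (psi G r n x) ⬝ᵥ potential r n) • psi G r n x) y = potential r n y := by
  rw [Finset.sum_apply, Finset.sum_eq_single_of_mem x hx]
  · exact psi_dotProduct_potential hG hxy
  · intro w hw hwx
    rw [Pi.smul_apply, psi_eq_zero, smul_zero]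
    exact fun h => hwx (owner_unique hG (hS w hw) h hxy)

theorem opRA_mulVec_potential (hG : G.IsTree) (hm : ∀ x, ¬ marked x) :
    opRA G r marked n *ᵥ potential r n = - potential r n := by
  classical
  rw [opRA_eq hG, reflection_mulVec]
  ext y
  obtain ⟨x, hx, hxy⟩ := exists_even_owner (r := r) hG y
  rw [Pi.sub_apply, Pi.smul_apply, sum_psi_potential hG (x := x) (by simp [hx, hm]) hxy]
  · simp
    ring
  · intro w hw
    simp_all

/-- Away from the root every entry is reflected as under `R_A`; the root entry is left fixed, and
`2|r⟩` corrects its sign. -/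
theorem opRB_mulVec_potential (hG : G.IsTree) (hm : ∀ x, ¬ marked x) :
    opRB G r marked n *ᵥ potential r n = (2 : ℂ) • ket r - potential r n := by
  classical
  rw [opRB_eq hG, reflection_mulVec]
  ext y
  by_cases hyr : y = r
  · subst hyr
    rw [Pi.sub_apply, Pi.smul_apply, Finset.sum_apply, Finset.sum_eq_zero]
    · simp [potential, ket_self]
      norm_num
    · intro x hx
      rw [Pi.smul_apply, psi_eq_zero, smul_zero]
      exact not_odd_owner_root (by simp_all)
  obtain ⟨x, hx, hxy⟩ := exists_odd_owner (r := r) hG hyr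
  rw [Pi.sub_apply, Pi.smul_apply, sum_psi_potential hG (x := x) (by simp [hx, hm]) hxy]
  · simp [ket_of_ne hyr]
    ring
  · intro w hw
    simp_all [← Nat.not_even_iff_odd]

theorem potential_norm_le {T : ℕ} (hT : Fintype.card V ≤ T) (hn : 1 ≤ n) :
    ∑ x, ‖potential r n x‖ ^ 2 ≤ (T : ℝ) * n := by
  have h1 : (1 : ℝ) ≤ n := by exact_mod_cast hn
  calc ∑ x, ‖potential r n x‖ ^ 2 ≤ ∑ _x : V, (n : ℝ) := by
        refine Finset.sum_le_sum fun x _ => ?_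
        unfold potential
        split_ifs
        · simpa using h1
        · rw [Complex.norm_real, Real.norm_eq_abs, sq_abs, Real.sq_sqrt (by linarith)]
    _ = Fintype.card V * (n : ℝ) := by simp
    _ ≤ T * n := by gcongr

end Operators

/-! ### Acceptance probability of phase estimation -/

section PhaseEstimation

open Matrix

variable {V : Type*} {s : ℕ}

theorem initState_of_ne {r : V} {p : V × Register s} (hp : p ≠ (r, 0)) : initState s r p = 0 := by
  simp [initState, hp]

theorem initState_self (r : V) : initState s r (r, 0) = 1 := by
  simp [initState]

variable [Fintype V] {RA RB : Matrix V V ℂ}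

theorem run_append (c d : Circuit s) (φ : V × Register s → ℂ) :
    Circuit.run RA RB (c ++ d) φ = Circuit.run RA RB d (Circuit.run RA RB c φ) := by
  simp [Circuit.run, List.foldl_append]

theorem run_cons (g : Gate s) (c : Circuit s) (φ : V × Register s → ℂ) :
    Circuit.run RA RB (g :: c) φ = Circuit.run RA RB c (g.apply RA RB φ) := rfl

/-- A unitary matrix preserves the norm. -/
theorem norm_sq_mulVec {ι : Type*} [Fintype ι] [DecidableEq ι] {M : Matrix ι ι ℂ}
    (hM : Mᴴ * M = 1) (v : ι → ℂ) : ∑ i, ‖(M *ᵥ v) i‖ ^ 2 = ∑ i, ‖v i‖ ^ 2 := by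
  have key : ∀ w : ι → ℂ, ((∑ i, ‖w i‖ ^ 2 : ℝ) : ℂ) = star w ⬝ᵥ w := by
    intro w
    simp only [dotProduct, Pi.star_apply, Complex.star_def, Complex.conj_mul']
    push_cast
    rfl
  apply Complex.ofReal_injective
  rw [key, key, star_mulVec, ← dotProduct_mulVec, mulVec_mulVec, hM, one_mulVec]

/-- Gates are block diagonal: a controlled gate acts as `M` or the identity for each register label,
an ancilla gate as the same unitary for each vertex. -/
theorem norm_sq_gate_apply [DecidableEq V] (hA : RAᴴ * RA = 1) (hB : RBᴴ * RB = 1) (g : Gate s)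
    (φ : V × Register s → ℂ) :
    ∑ p, ‖g.apply RA RB φ p‖ ^ 2 = ∑ p, ‖φ p‖ ^ 2 := by
  have hctrl : ∀ (M : Matrix V V ℂ) (j : Fin s), Mᴴ * M = 1 →
      ∑ p, ‖controlled M j φ p‖ ^ 2 = ∑ p, ‖φ p‖ ^ 2 := by
    intro M j hM
    rw [Fintype.sum_prod_type_right, Fintype.sum_prod_type_right]
    refine Finset.sum_congr rfl fun b _ => ?_
    by_cases hb : b j = 1
    · simp only [controlled, hb, if_true]
      exact norm_sq_mulVec hM fun x => φ (x, b)
    · simp only [controlled, hb, if_false]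
  cases g with
  | ancilla W =>
    rw [Fintype.sum_prod_type, Fintype.sum_prod_type]
    refine Finset.sum_congr rfl fun x _ => ?_
    exact norm_sq_mulVec (mem_unitaryGroup_iff'.1 W.2) fun b => φ (x, b)
  | ctrlRA j => exact hctrl RA j hA
  | ctrlRB j => exact hctrl RB j hB

theorem norm_sq_run [DecidableEq V] (hA : RAᴴ * RA = 1) (hB : RBᴴ * RB = 1) (c : Circuit s)
    (φ : V × Register s → ℂ) :
    ∑ p, ‖Circuit.run RA RB c φ p‖ ^ 2 = ∑ p, ‖φ p‖ ^ 2 := by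
  induction c generalizing φ with
  | nil => rfl
  | cons g c ih => rw [run_cons, ih, norm_sq_gate_apply hA hB]

theorem runProb_nonneg (r : V) (a : Register s) : 0 ≤ runProb RA RB r s a :=
  Finset.sum_nonneg fun _ _ => by positivity

theorem sum_runProb [DecidableEq V] (hA : RAᴴ * RA = 1) (hB : RBᴴ * RB = 1) (r : V) :
    ∑ a, runProb RA RB r s a = 1 := by
  simp only [runProb, bornProb]
  rw [← Fintype.sum_prod_type_right fun p : V × Register s =>
    ‖(phaseEstimation s).run RA RB (initState s r) p‖ ^ 2, norm_sq_run hA hB,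
    Finset.sum_eq_single (r, 0)]
  · simp [initState_self]
  · intro p _ hp
    simp [initState_of_ne hp]
  · simp

/-- The state in which the register has the label `b` and `U ^ e b` has been applied to `v`. -/
theorem run_controlled_power [DecidableEq V] (j : Fin s) (m : ℕ) (e : Register s → ℕ) (v : V → ℂ) :
    Circuit.run RA RB (List.replicate m [Gate.ctrlRA j, Gate.ctrlRB j]).flatten
      (fun p => (((RB * RA) ^ e p.2) *ᵥ v) p.1) =
      fun p => (((RB * RA) ^ (e p.2 + (p.2 j : ℕ) * m)) *ᵥ v) p.1 := by
  induction m generalizing e with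
  | zero => simp [Circuit.run]
  | succ m ih =>
    rw [List.replicate_succ, List.flatten_cons, run_append]
    have hstep : Circuit.run RA RB [Gate.ctrlRA j, Gate.ctrlRB j]
        (fun p => (((RB * RA) ^ e p.2) *ᵥ v) p.1) =
        fun p => (((RB * RA) ^ (e p.2 + (p.2 j : ℕ))) *ᵥ v) p.1 := by
      funext ⟨x, b⟩
      have hb : b j = 0 ∨ b j = 1 := by
        generalize b j = t
        revert t
        decide
      rcases hb with hb | hb
      · simp [Circuit.run, Gate.apply, controlled, hb]
      · change _ = (((RB * RA) ^ (e b + (b j : ℕ))) *ᵥ v) x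
        rw [hb, Fin.val_one, add_comm, pow_add, pow_one, ← mulVec_mulVec, ← mulVec_mulVec]
        simp only [Circuit.run, Gate.apply, controlled, hb, List.foldl_cons, List.foldl_nil,
          if_true]
        rfl
    rw [hstep, ih fun b => e b + (b j : ℕ)]
    funext p
    rw [add_assoc, mul_add_one, add_comm ((p.2 j : ℕ) * m)]

/-- Bit `j` adds `2 ^ j` to the exponent when set, so running through all qubits produces the number
with binary digits `b`. -/
theorem run_controlled_powers [DecidableEq V] (l : List (Fin s)) (e : Register s → ℕ) (v : V → ℂ) :
    Circuit.run RA RB (l.flatMap fun j : Fin s =>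
      (List.replicate (2 ^ (j : ℕ)) [Gate.ctrlRA j, Gate.ctrlRB j]).flatten)
      (fun p => (((RB * RA) ^ e p.2) *ᵥ v) p.1) =
      fun p => (((RB * RA) ^ (e p.2 + (l.map fun j : Fin s => (p.2 j : ℕ) * 2 ^ (j : ℕ)).sum)) *ᵥ v) p.1 := by
  induction l generalizing e with
  | nil => simp [Circuit.run]
  | cons j l ih =>
    rw [List.flatMap_cons, run_append, run_controlled_power,
      ih fun b => e b + (b j : ℕ) * 2 ^ (j : ℕ)]
    simp only [List.map_cons, List.sum_cons, add_assoc]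

theorem inv_sqrt_two_pow_mul_self (s : ℕ) :
    ((1 / Real.sqrt (2 ^ s) : ℝ) : ℂ) * ((1 / Real.sqrt (2 ^ s) : ℝ) : ℂ) = 1 / 2 ^ s := by
  rw [← Complex.ofReal_mul, div_mul_div_comm, Real.mul_self_sqrt (by positivity)]
  push_cast
  ring

theorem hadamardAll_apply_zero (b : Register s) :
    hadamardAll s b 0 = ((1 / Real.sqrt (2 ^ s) : ℝ) : ℂ) := by
  have h : ∀ t : Fin 2, hadamard t 0 = ((1 / Real.sqrt 2 : ℝ) : ℂ) := by
    intro t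
    fin_cases t <;> simp [hadamard]
  have h2 : Real.sqrt (2 ^ s) = Real.sqrt 2 ^ s := by
    rw [Real.sqrt_eq_iff_mul_self_eq (by positivity) (by positivity), ← mul_pow,
      Real.mul_self_sqrt (by norm_num)]
  simp [hadamardAll, h, h2]

theorem invQFT_zero_apply (b : Register s) :
    invQFT s 0 b = ((1 / Real.sqrt (2 ^ s) : ℝ) : ℂ) := by
  have : (finFunctionFinEquiv (0 : Register s) : ℕ) = 0 := by
    simp
  simp [invQFT, this]

/-- The probability that phase estimation accepts, as the norm of an average of powers. -/
theorem runProb_zero [DecidableEq V] (r : V) :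
    runProb RA RB r s 0 =
      ∑ x, ‖(1 / 2 ^ s : ℂ) * ∑ k ∈ Finset.range (2 ^ s), (((RB * RA) ^ k) *ᵥ ket r) x‖ ^ 2 := by
  rw [runProb, bornProb]
  refine Finset.sum_congr rfl fun x _ => ?_
  congr 2
  -- The uniform superposition is written with `U ^ 0`, the shape that `run_controlled_powers` takes
  -- as input.
  have hinit : (Gate.ancilla ⟨hadamardAll s, hadamardAll_mem s⟩).apply RA RB (initState s r) =
      fun p => (((RB * RA) ^ 0) *ᵥ (((1 / Real.sqrt (2 ^ s) : ℝ) : ℂ) • ket r)) p.1 := by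
    funext ⟨x, b⟩
    simp only [Gate.apply, pow_zero, one_mulVec]
    rw [Finset.sum_eq_single (0 : Register s)]
    · rw [hadamardAll_apply_zero]
      by_cases hx : x = r
      · subst hx
        simp [initState_self, ket_self]
      · rw [initState_of_ne (by simp [hx])]
        simp [ket_of_ne hx]
    · intro a _ ha
      rw [initState_of_ne (by simp [ha]), mul_zero]
    · simp
  rw [phaseEstimation, run_append, run_append]
  have h1 : Circuit.run RA RB [Gate.ancilla ⟨hadamardAll s, hadamardAll_mem s⟩] (initState s r) =
      fun p => (((RB * RA) ^ 0) *ᵥ (((1 / Real.sqrt (2 ^ s) : ℝ) : ℂ) • ket r)) p.1 := hinit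
  rw [h1, run_controlled_powers _ fun _ => 0]
  have hnum : ∀ b : Register s,
      ((List.finRange s).map fun j : Fin s => (b j : ℕ) * 2 ^ (j : ℕ)).sum = finFunctionFinEquiv b := by
    intro b
    rw [finFunctionFinEquiv_apply, ← List.ofFn_eq_map, List.sum_ofFn]
  -- Row zero of the inverse transform is constant, so outcome `0` just averages over labels, and
  -- each `k < 2 ^ s` is the value of exactly one label.
  simp only [Circuit.run, Gate.apply, List.foldl_cons, List.foldl_nil, invQFT_zero_apply, hnum,
    zero_add, mulVec_smul, Pi.smul_apply, smul_eq_mul, ← mul_assoc, inv_sqrt_two_pow_mul_self]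
  rw [← Finset.mul_sum, ← Fin.sum_univ_eq_sum_range fun k => (((RB * RA) ^ k) *ᵥ ket r) x]
  congr 1
  exact Equiv.sum_comp finFunctionFinEquiv
    fun k : Fin (2 ^ s) => (((RB * RA) ^ (k : ℕ)) *ᵥ ket r) x

/-- Eigenvectors with eigenvalue one give a lower bound for the acceptance probability. -/
theorem le_runProb_zero [DecidableEq V] (hA : RA.IsHermitian) (hB : RB.IsHermitian) {r : V}
    {φ : V → ℂ} (hφA : RA *ᵥ φ = φ) (hφB : RB *ᵥ φ = φ) :
    ‖φ r‖ ^ 2 ≤ (∑ x, ‖φ x‖ ^ 2) * runProb RA RB r s 0 := by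
  -- Hermitian operators fixing `φ` also fix `⟨φ|`; hence the averaged state has the same overlap
  -- with `φ` as `|r⟩`, and Cauchy–Schwarz finishes.
  have hU : ∀ k v, star φ ⬝ᵥ (((RB * RA) ^ k) *ᵥ v) = star φ ⬝ᵥ v := by
    have hM : ∀ {M : Matrix V V ℂ} (v : V → ℂ), M.IsHermitian → M *ᵥ φ = φ →
        star φ ⬝ᵥ (M *ᵥ v) = star φ ⬝ᵥ v := by
      intro M v hM hφ
      rw [dotProduct_mulVec, ← hM.eq, ← star_mulVec, hφ]
    intro k v
    induction k with
    | zero => simp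
    | succ k ih => rw [pow_succ', ← mulVec_mulVec, ← mulVec_mulVec, hM _ hB hφB, hM _ hA hφA, ih]
  have hket : star φ ⬝ᵥ ket r = star (φ r) := by
    rw [dotProduct, Finset.sum_eq_single r]
    · simp [ket_self]
    · intro x _ hx
      simp [ket_of_ne hx]
    · simp
  have hin : ∑ x, star (φ x) *
      ((1 / 2 ^ s : ℂ) * ∑ k ∈ Finset.range (2 ^ s), (((RB * RA) ^ k) *ᵥ ket r) x) =
      star (φ r) := by
    have : ∀ x, star (φ x) *
        ((1 / 2 ^ s : ℂ) * ∑ k ∈ Finset.range (2 ^ s), (((RB * RA) ^ k) *ᵥ ket r) x) =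
        (1 / 2 ^ s : ℂ) * ∑ k ∈ Finset.range (2 ^ s), star (φ x) * (((RB * RA) ^ k) *ᵥ ket r) x := by
      intro x
      rw [← Finset.mul_sum]
      ring
    simp only [this]
    rw [← Finset.mul_sum, Finset.sum_comm]
    have h2 : ∀ k, ∑ x, star (φ x) * (((RB * RA) ^ k) *ᵥ ket r) x = star (φ r) := by
      intro k
      rw [← hket, ← hU k]
      rfl
    simp only [h2, Finset.sum_const, Finset.card_range, nsmul_eq_mul]
    push_cast
    field_simp
  rw [runProb_zero, ← norm_star (φ r), ← hin]
  calc _ ≤ (∑ x, ‖φ x‖ *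
        ‖(1 / 2 ^ s : ℂ) * ∑ k ∈ Finset.range (2 ^ s), (((RB * RA) ^ k) *ᵥ ket r) x‖) ^ 2 := by
        gcongr
        refine (norm_sum_le _ _).trans_eq (Finset.sum_congr rfl fun x _ => ?_)
        rw [norm_mul, norm_star]
    _ ≤ _ := Finset.sum_mul_sq_le_sq_mul_sq _ _ _

/-- If `2 |r⟩ = η - U η`, the average of the powers of `U` on `|r⟩` telescopes. -/
theorem runProb_zero_le [DecidableEq V] (hA : RAᴴ * RA = 1) (hB : RBᴴ * RB = 1) {r : V}
    {η : V → ℂ} (hη : (2 : ℂ) • ket r = η - (RB * RA) *ᵥ η) :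
    runProb RA RB r s 0 ≤ (∑ x, ‖η x‖ ^ 2) / (2 ^ s) ^ 2 := by
  set U := RB * RA with hUdef
  have hU : Uᴴ * U = 1 := by
    rw [hUdef, conjTranspose_mul, mul_assoc, ← mul_assoc RBᴴ, hB, one_mul, hA]
  have htel : ∀ m, (2 : ℂ) • ∑ k ∈ Finset.range m, (U ^ k) *ᵥ ket r = η - (U ^ m) *ᵥ η := by
    intro m
    induction m with
    | zero => simp
    | succ m ih =>
      rw [Finset.sum_range_succ, smul_add, ih, ← mulVec_smul, hη, mulVec_sub, mulVec_mulVec,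
        ← pow_succ]
      abel
  have hnorm : ∀ m, ∑ x, ‖((U ^ m) *ᵥ η) x‖ ^ 2 = ∑ x, ‖η x‖ ^ 2 := by
    intro m
    induction m with
    | zero => simp
    | succ m ih => rw [pow_succ', ← mulVec_mulVec, norm_sq_mulVec hU, ih]
  have hterm : ∀ x, ‖(1 / 2 ^ s : ℂ) * ∑ k ∈ Finset.range (2 ^ s), ((U ^ k) *ᵥ ket r) x‖ ^ 2 ≤
      (‖η x‖ ^ 2 + ‖((U ^ 2 ^ s) *ᵥ η) x‖ ^ 2) / (2 * (2 ^ s) ^ 2) := by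
    intro x
    have h := congrFun (htel (2 ^ s)) x
    rw [Pi.smul_apply, Finset.sum_apply, smul_eq_mul, Pi.sub_apply] at h
    have h2 : (1 / 2 ^ s : ℂ) * ∑ k ∈ Finset.range (2 ^ s), ((U ^ k) *ᵥ ket r) x =
        (η x - ((U ^ 2 ^ s) *ᵥ η) x) / (2 * 2 ^ s) := by
      rw [← h]
      field_simp
    rw [h2, norm_div, div_pow]
    have h3 : ‖(2 * 2 ^ s : ℂ)‖ = 2 * 2 ^ s := by simp
    -- Since `U` preserves the norm, summing this over `x` gives `4‖η‖²`, which cancels the `4` in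
    -- `(2 · 2^s)²`.
    have h4 : ‖η x - ((U ^ 2 ^ s) *ᵥ η) x‖ ^ 2 ≤
        2 * (‖η x‖ ^ 2 + ‖((U ^ 2 ^ s) *ᵥ η) x‖ ^ 2) := by
      have h5 := norm_sub_le (η x) (((U ^ 2 ^ s) *ᵥ η) x)
      have h6 := norm_nonneg (η x - ((U ^ 2 ^ s) *ᵥ η) x)
      nlinarith [sq_nonneg (‖η x‖ - ‖((U ^ 2 ^ s) *ᵥ η) x‖)]
    rw [h3, div_le_div_iff₀ (by positivity) (by positivity)]
    have h7 : (0 : ℝ) ≤ 2 * (2 ^ s) ^ 2 := by positivity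
    nlinarith [mul_le_mul_of_nonneg_right h4 h7]
  rw [runProb_zero]
  refine (Finset.sum_le_sum fun x _ => hterm x).trans_eq ?_
  rw [← Finset.sum_div, Finset.sum_add_distrib, hnorm]
  field_simp
  ring

end PhaseEstimation

/-! ### Tail bounds for the number of accepting runs -/

section Tails

variable {α : Type*} [Fintype α] [DecidableEq α] {p : α → ℝ} {a₀ : α} {K : ℕ}

/-- The exponential moment of the number of occurrences of `a₀` in `K` independent samples. -/
theorem sum_prod_mul_pow_count (h1 : ∑ a, p a = 1) (z : ℝ) :
    ∑ o : Fin K → α, (∏ i, p (o i)) * z ^ (Finset.univ.filter (fun i => o i = a₀)).card =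
      (1 - p a₀ + p a₀ * z) ^ K := by
  have hbase : 1 - p a₀ + p a₀ * z = ∑ a, p a * (if a = a₀ then z else 1) := by
    have : ∀ a, p a * (if a = a₀ then z else 1) = p a + if a = a₀ then p a₀ * (z - 1) else 0 := by
      intro a
      split_ifs with h
      · rw [h]
        ring
      · ring
    simp only [this, Finset.sum_add_distrib, h1, Finset.sum_ite_eq', Finset.mem_univ, if_true]
    ring
  rw [hbase, Fintype.sum_pow]
  refine Finset.sum_congr rfl fun o _ => ?_
  rw [Finset.prod_mul_distrib, Finset.prod_ite, Finset.prod_const, Finset.prod_const_one, mul_one]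

/-- The exponential Markov inequality, for an event on which `w ^ (8 X) ≥ w ^ (3 K)`. -/
theorem sum_prod_le_of_pow_le (h0 : ∀ a, 0 ≤ p a) (h1 : ∑ a, p a = 1) {w q : ℝ} (hw : 0 < w)
    (hq : 1 - p a₀ + p a₀ * w ^ 8 ≤ q * w ^ 3) (s : Finset (Fin K → α))
    (hs : ∀ o ∈ s, w ^ (3 * K) ≤ w ^ (8 * (Finset.univ.filter (fun i => o i = a₀)).card)) :
    ∑ o ∈ s, ∏ i, p (o i) ≤ q ^ K := by
  have hp1 : p a₀ ≤ 1 := h1 ▸ Finset.single_le_sum (fun a _ => h0 a) (Finset.mem_univ a₀)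
  have hprod : ∀ o : Fin K → α, 0 ≤ ∏ i, p (o i) := fun o => Finset.prod_nonneg fun i _ => h0 _
  set X : (Fin K → α) → ℕ := fun o => (Finset.univ.filter (fun i => o i = a₀)).card with hX
  have hnn : ∀ o : Fin K → α, 0 ≤ (∏ i, p (o i)) * (w ^ 8) ^ X o :=
    fun o => mul_nonneg (hprod o) (pow_nonneg (pow_nonneg hw.le 8) _)
  -- The Markov parameter is `z = w ^ 8`, so that the threshold value `z ^ (3K/8)` is the integer
  -- power `w ^ (3K)`.
  have hmul : (∑ o ∈ s, ∏ i, p (o i)) * w ^ (3 * K) ≤ q ^ K * w ^ (3 * K) := by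
    calc (∑ o ∈ s, ∏ i, p (o i)) * w ^ (3 * K)
        = ∑ o ∈ s, (∏ i, p (o i)) * w ^ (3 * K) := Finset.sum_mul _ _ _
      _ ≤ ∑ o ∈ s, (∏ i, p (o i)) * (w ^ 8) ^ X o := by
          refine Finset.sum_le_sum fun o ho => mul_le_mul_of_nonneg_left ?_ (hprod o)
          rw [← pow_mul w 8 (X o)]
          exact hs o ho
      _ ≤ ∑ o, (∏ i, p (o i)) * (w ^ 8) ^ X o :=
          Finset.sum_le_sum_of_subset_of_nonneg (Finset.subset_univ s) fun o _ _ => hnn o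
      _ = (1 - p a₀ + p a₀ * w ^ 8) ^ K := sum_prod_mul_pow_count h1 _
      _ ≤ (q * w ^ 3) ^ K := by
          refine pow_le_pow_left₀ ?_ hq K
          have := mul_nonneg (h0 a₀) (pow_pos hw 8).le
          linarith
      _ = q ^ K * w ^ (3 * K) := by rw [mul_pow, ← pow_mul]
  exact le_of_mul_le_mul_right hmul (by positivity)

/-- Few occurrences are unlikely if `a₀` has probability at least `1 / 2`. -/
theorem lower_tail (h0 : ∀ a, 0 ≤ p a) (h1 : ∑ a, p a = 1) (hp : 1 / 2 ≤ p a₀)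
    (s : Finset (Fin K → α))
    (hs : ∀ o ∈ s, 8 * (Finset.univ.filter (fun i => o i = a₀)).card ≤ 3 * K) :
    ∑ o ∈ s, ∏ i, p (o i) ≤ (49 / 50) ^ K := by
  -- For `w < 1` the worst case is `p a₀ = 1/2`, where `(1 + w^8)/2 ≤ (49/50) w^3` holds at `w =
  -- 10/11`.
  refine sum_prod_le_of_pow_le (a₀ := a₀) h0 h1 (w := 10 / 11) (by norm_num) ?_ s fun o ho => ?_
  · norm_num
    linarith
  · exact pow_le_pow_of_le_one (by norm_num) (by norm_num) (hs o ho)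

/-- Many occurrences are unlikely if `a₀` has probability at most `1 / 4`. -/
theorem upper_tail (h0 : ∀ a, 0 ≤ p a) (h1 : ∑ a, p a = 1) (hp : p a₀ ≤ 1 / 4)
    (s : Finset (Fin K → α))
    (hs : ∀ o ∈ s, 3 * K ≤ 8 * (Finset.univ.filter (fun i => o i = a₀)).card) :
    ∑ o ∈ s, ∏ i, p (o i) ≤ (49 / 50) ^ K := by
  -- For `w > 1` the worst case is `p a₀ = 1/4`, where `(3 + w^8)/4 ≤ (49/50) w^3` holds at `w =
  -- 11/10`.
  refine sum_prod_le_of_pow_le (a₀ := a₀) h0 h1 (w := 11 / 10) (by norm_num) ?_ s fun o ho => ?_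
  · norm_num
    linarith
  · exact pow_le_pow_right₀ (by norm_num) (hs o ho)

end Tails

/-! ### Number of repetitions, precision and query count -/

section Parameters

/-- The value `γ = 50` matches `49/50 ≤ exp (-1/50)`. -/
theorem pow_detectReps_le {δ : ℝ} (hδ : 0 < δ) : (49 / 50 : ℝ) ^ detectReps 50 δ ≤ δ := by
  have h := Nat.le_ceil (50 * Real.log (1 / δ))
  rw [one_div, Real.log_inv] at h
  calc (49 / 50 : ℝ) ^ detectReps 50 δ ≤ Real.exp (-(1 / 50)) ^ detectReps 50 δ := by
        refine pow_le_pow_left₀ (by norm_num) ?_ _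
        have := Real.add_one_le_exp (-(1 / 50) : ℝ)
        linarith
    _ = Real.exp (-(detectReps 50 δ / 50)) := by
        rw [← Real.exp_nat_mul]
        ring_nf
    _ ≤ Real.exp (Real.log δ) := by
        rw [Real.exp_le_exp, detectReps, one_div, Real.log_inv]
        linarith
    _ = δ := Real.exp_log hδ

theorem le_two_pow_precisionBits {ε : ℝ} (hε : 0 < ε) : 1 / ε ≤ 2 ^ precisionBits ε := by
  have h : Real.logb 2 (1 / ε) ≤ precisionBits ε :=
    (Nat.le_ceil _).trans (Nat.cast_le.2 (le_max_right _ _))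
  rwa [Real.logb_le_iff_le_rpow (by norm_num) (by positivity), Real.rpow_natCast] at h

/-- Rounding the exponent up costs a factor `2`; the summand `1` covers large `ε`, where the
convention `s ≥ 1` takes over. -/
theorem two_pow_precisionBits_le {ε : ℝ} (hε : 0 < ε) :
    (2 : ℝ) ^ precisionBits ε ≤ 2 * (1 + 1 / ε) := by
  have hε' : 0 < 1 / ε := by positivity
  have hceil : (2 : ℝ) ^ ⌈Real.logb 2 (1 / ε)⌉₊ ≤ 2 * (1 + 1 / ε) := by
    rcases le_or_gt (Real.logb 2 (1 / ε)) 0 with h | h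
    · rw [Nat.ceil_eq_zero.2 h]
      linarith
    · have h2 := (Nat.ceil_lt_add_one h.le).le
      rw [← Real.rpow_natCast]
      calc (2 : ℝ) ^ (⌈Real.logb 2 (1 / ε)⌉₊ : ℝ) ≤ 2 ^ (Real.logb 2 (1 / ε) + 1) :=
            Real.rpow_le_rpow_of_exponent_le (by norm_num) h2
        _ = 1 / ε * 2 := by
            rw [Real.rpow_add (by norm_num), Real.rpow_one,
              Real.rpow_logb (by norm_num) (by norm_num) hε']
        _ ≤ _ := by linarith
  rcases max_choice 1 ⌈Real.logb 2 (1 / ε)⌉₊ with h | h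
  · rw [precisionBits, h]
    linarith
  · rw [precisionBits, h]
    exact hceil

/-- The block of qubit `j` contributes `2 ^ j`. The weight `f` is left general so that both
operators are counted at once. -/
theorem sum_map_phaseEstimation {s : ℕ} (f : Gate s → ℕ) (h0 : ∀ W, f (Gate.ancilla W) = 0)
    (h1 : ∀ j, f (Gate.ctrlRA j) + f (Gate.ctrlRB j) = 1) :
    ((phaseEstimation s).map f).sum = 2 ^ s - 1 := by
  have hblock : ∀ (j : Fin s) (m : ℕ),
      ((List.replicate m [Gate.ctrlRA j, Gate.ctrlRB j]).flatten.map f).sum = m := by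
    intro j m
    induction m with
    | zero => simp
    | succ m ih =>
      rw [List.replicate_succ, List.flatten_cons, List.map_append, List.sum_append, ih]
      simp only [List.map_cons, List.map_nil, List.sum_cons, List.sum_nil, add_zero, h1]
      ring
  have hmid : ∀ l : List (Fin s), ((l.flatMap fun j : Fin s =>
      (List.replicate (2 ^ (j : ℕ)) [Gate.ctrlRA j, Gate.ctrlRB j]).flatten).map f).sum =
      (l.map fun j : Fin s => 2 ^ (j : ℕ)).sum := by
    intro l
    induction l with
    | nil => rfl
    | cons j l ih =>
      rw [List.flatMap_cons, List.map_append, List.sum_append, ih, hblock, List.map_cons,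
        List.sum_cons]
  rw [phaseEstimation, List.map_append, List.map_append, List.sum_append, List.sum_append, hmid]
  simp only [List.map_cons, List.map_nil, List.sum_cons, List.sum_nil, h0, zero_add, add_zero]
  rw [← List.ofFn_eq_map, List.sum_ofFn, Fin.sum_univ_eq_sum_range fun j => 2 ^ j,
    Nat.geomSum_eq le_rfl]
  simp

theorem usesRA_phaseEstimation (s : ℕ) : (phaseEstimation s).usesRA = 2 ^ s - 1 :=
  sum_map_phaseEstimation _ (fun _ => rfl) fun _ => rfl

theorem usesRB_phaseEstimation (s : ℕ) : (phaseEstimation s).usesRB = 2 ^ s - 1 :=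
  sum_map_phaseEstimation _ (fun _ => rfl) fun _ => rfl

theorem uses_le {β γ : ℝ} (hβ : 0 < β) (hγ : 0 < γ) {T n : ℕ} (hT : 1 ≤ T) (hn : 1 ≤ n) {δ : ℝ}
    (hδ : 0 < δ) (hδ1 : δ < 1) :
    ((detectReps γ δ * (2 ^ detectBits β T n - 1) : ℕ) : ℝ) ≤
        2 * (1 + 1 / β) * (γ + 2) * Real.sqrt ((T : ℝ) * n) * (1 + Real.log (1 / δ)) ∧
      (δ ≤ 1 / 2 → ((detectReps γ δ * (2 ^ detectBits β T n - 1) : ℕ) : ℝ) ≤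
        2 * (1 + 1 / β) * (γ + 2) * Real.sqrt ((T : ℝ) * n) * Real.log (1 / δ)) := by
  set q := Real.sqrt ((T : ℝ) * n) with hq
  have hq1 : 1 ≤ q := by
    rw [hq, Real.one_le_sqrt]
    exact_mod_cast Nat.one_le_iff_ne_zero.2 (Nat.mul_ne_zero (by omega) (by omega))
  have hbits : ((2 ^ detectBits β T n - 1 : ℕ) : ℝ) ≤ 2 * (1 + 1 / β) * q := by
    have h1 : ((2 ^ detectBits β T n - 1 : ℕ) : ℝ) ≤ ((2 ^ detectBits β T n : ℕ) : ℝ) :=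
      Nat.cast_le.2 (Nat.sub_le _ _)
    have h2 := two_pow_precisionBits_le (ε := β / q) (by positivity)
    rw [one_div_div] at h2
    push_cast at h1
    calc _ ≤ _ := h1
      _ ≤ 2 * (1 + q / β) := h2
      _ ≤ 2 * (q + q / β) := by gcongr
      _ = _ := by ring
  have hlog : 0 < Real.log (1 / δ) := Real.log_pos (by rw [lt_div_iff₀ hδ]; linarith)
  have hreps : (detectReps γ δ : ℝ) ≤ γ * Real.log (1 / δ) + 1 :=
    (Nat.ceil_lt_add_one (by positivity)).le
  -- The `+ 1` from the ceiling in `K` has to be absorbed: `L = 1 + log (1/δ)` does so always, `L =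
  -- log (1/δ)` only for `δ ≤ 1/2`.
  have key : ∀ L : ℝ, γ * Real.log (1 / δ) + 1 ≤ (γ + 2) * L →
      ((detectReps γ δ * (2 ^ detectBits β T n - 1) : ℕ) : ℝ) ≤
        2 * (1 + 1 / β) * (γ + 2) * q * L := by
    intro L hL
    rw [Nat.cast_mul]
    calc _ ≤ ((γ + 2) * L) * (2 * (1 + 1 / β) * q) :=
          mul_le_mul (hreps.trans hL) hbits (Nat.cast_nonneg _)
            ((Nat.cast_nonneg _).trans (hreps.trans hL))
      _ = _ := by ring
  refine ⟨key _ (by nlinarith), fun h => key _ ?_⟩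
  have hlog2 : Real.log 2 ≤ Real.log (1 / δ) := by
    refine Real.log_le_log (by norm_num) ?_
    rw [le_div_iff₀ hδ]
    linarith
  -- As `log 2 > 1/2`, the extra `1` is at most `2 log (1/δ)`; hence the constant `γ + 2`.
  have := Real.log_two_gt_d9
  linarith

end Parameters

/-! ### Error probability of the algorithm -/

section Correctness

open Matrix

variable {V : Type*} [Fintype V] {RA RB : Matrix V V ℂ} {r : V} {T n : ℕ} {δ : ℝ}

theorem outputProb_false_add_true [DecidableEq V] (hA : RAᴴ * RA = 1) (hB : RBᴴ * RB = 1)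
    (β γ : ℝ) :
    outputProb RA RB r β γ T n δ false + outputProb RA RB r β γ T n δ true = 1 := by
  have h := Finset.sum_filter_add_sum_filter_not
    (Finset.univ : Finset (Fin (detectReps γ δ) → Register (detectBits β T n)))
    (fun o => decision o = false) fun o => ∏ i, runProb RA RB r (detectBits β T n) (o i)
  simp only [Bool.not_eq_false] at h
  rw [outputProb, outputProb, h, ← Fintype.sum_pow, sum_runProb hA hB, one_pow]

theorem outputProb_false_le [DecidableEq V] (hA : RAᴴ * RA = 1) (hB : RBᴴ * RB = 1)
    {β : ℝ} (hδ : 0 < δ) (hp : 1 / 2 ≤ runProb RA RB r (detectBits β T n) 0) :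
    outputProb RA RB r β 50 T n δ false ≤ δ := by
  refine (lower_tail (runProb_nonneg r) (sum_runProb hA hB r) hp _ fun o ho => ?_).trans
    (pow_detectReps_le hδ)
  have := (Finset.mem_filter.1 ho).2
  rw [decision, decide_eq_false_iff_not, not_le] at this
  exact this.le

theorem outputProb_true_le [DecidableEq V] (hA : RAᴴ * RA = 1) (hB : RBᴴ * RB = 1)
    {β : ℝ} (hδ : 0 < δ) (hp : runProb RA RB r (detectBits β T n) 0 ≤ 1 / 4) :
    outputProb RA RB r β 50 T n δ true ≤ δ := by
  refine (upper_tail (runProb_nonneg r) (sum_runProb hA hB r) hp _ fun o ho => ?_).trans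
    (pow_detectReps_le hδ)
  have := (Finset.mem_filter.1 ho).2
  rwa [decision, decide_eq_true_iff] at this

variable {G : SimpleGraph V} {marked : V → Prop}

/-- The fixed vector gives `n ≤ 2n · p` for the acceptance probability `p`, whatever the precision
`s`. -/
theorem half_le_runProb_of_marked (hG : G.IsTree) (hn : 1 ≤ n) (hd : ∀ x, G.dist r x ≤ n)
    (hr : ¬ marked r) (hm : ∃ x, marked x) (s : ℕ) :
    1 / 2 ≤ runProb (opRA G r marked n) (opRB G r marked n) r s 0 := by
  classical
  obtain ⟨x, hx⟩ := hm
  obtain ⟨φ, hA, hB, hφr, hφ⟩ := exists_fixed_vector hG hd hx hr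
  have h := le_runProb_zero (s := s) (opRA_isHermitian hG) (opRB_isHermitian hG) (r := r) hA hB
  have hn' : (0 : ℝ) < n := by exact_mod_cast hn
  rw [hφr, Complex.norm_real, Real.norm_eq_abs, sq_abs, Real.sq_sqrt hn'.le] at h
  have h2 := h.trans (mul_le_mul_of_nonneg_right hφ (runProb_nonneg r 0))
  have h3 : (n : ℝ) * (1 / 2) ≤
      n * runProb (opRA G r marked n) (opRB G r marked n) r s 0 := by linarith
  exact le_of_mul_le_mul_left (by linarith) hn'

theorem runProb_le_of_unmarked (hG : G.IsTree) (hT : Fintype.card V ≤ T) (hn : 1 ≤ n)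
    (hm : ¬ ∃ x, marked x) :
    runProb (opRA G r marked n) (opRB G r marked n) r (detectBits (1 / 2) T n) 0 ≤ 1 / 4 := by
  classical
  push Not at hm
  -- `U η = R_B (-η) = η - 2|r⟩`.
  have hη : (2 : ℂ) • ket r = potential r n -
      (opRB G r marked n * opRA G r marked n) *ᵥ potential r n := by
    rw [← mulVec_mulVec, opRA_mulVec_potential hG hm, mulVec_neg, opRB_mulVec_potential hG hm]
    abel
  have hA : (opRA G r marked n)ᴴ * opRA G r marked n = 1 := by
    rw [(opRA_isHermitian hG).eq, opRA_sq hG]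
  have hB : (opRB G r marked n)ᴴ * opRB G r marked n = 1 := by
    rw [(opRB_isHermitian hG).eq, opRB_sq hG]
  refine (runProb_zero_le hA hB hη).trans ?_
  have hT0 : (0 : ℝ) < T := by
    exact_mod_cast (Fintype.card_pos_iff.2 ⟨r⟩).trans_le hT
  have hn0 : (0 : ℝ) < n := by exact_mod_cast hn
  have hq : 0 < Real.sqrt ((T : ℝ) * n) := Real.sqrt_pos.2 (by positivity)
  have hbits := le_two_pow_precisionBits (ε := 1 / 2 / Real.sqrt ((T : ℝ) * n)) (by positivity)
  -- Here `β = 1/2` enters: squaring gives `4 T n ≤ (2 ^ s) ^ 2`, against `‖η‖² ≤ T n`.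
  have h2 : 2 * Real.sqrt ((T : ℝ) * n) ≤ 2 ^ detectBits (1 / 2) T n := by
    refine le_trans (le_of_eq ?_) hbits
    field_simp
  rw [div_le_iff₀ (by positivity)]
  have h3 := pow_le_pow_left₀ (by positivity) h2 2
  rw [mul_pow, Real.sq_sqrt (by positivity)] at h3
  have := potential_norm_le (r := r) hT hn
  linarith

end Correctness

end TreeWalk

theorem mainTheorem3 :
    -- the number of uses of the two walk operators
    (∀ β γ : ℝ, 0 < β → 0 < γ → ∃ C : ℝ, 0 < C ∧
      ∀ T n : ℕ, 1 ≤ T → 1 ≤ n → ∀ δ : ℝ, 0 < δ → δ < 1 →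
        (TreeWalk.detectUsesRA β γ T n δ : ℝ) ≤
            C * Real.sqrt ((T : ℝ) * n) * (1 + Real.log (1 / δ)) ∧
        (TreeWalk.detectUsesRB β γ T n δ : ℝ) ≤
            C * Real.sqrt ((T : ℝ) * n) * (1 + Real.log (1 / δ)) ∧
        (δ ≤ 1 / 2 →
          (TreeWalk.detectUsesRA β γ T n δ : ℝ) ≤
              C * Real.sqrt ((T : ℝ) * n) * Real.log (1 / δ) ∧
          (TreeWalk.detectUsesRB β γ T n δ : ℝ) ≤
              C * Real.sqrt ((T : ℝ) * n) * Real.log (1 / δ))) ∧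
    -- correctness, for suitable universal constants
    (∃ β γ : ℝ, 0 < β ∧ 0 < γ ∧
      ∀ (V : Type*) [Fintype V] (G : SimpleGraph V) (r : V) (marked : V → Prop) (T n : ℕ) (δ : ℝ),
        G.IsTree → Fintype.card V ≤ T → 1 ≤ n → (∀ x, G.dist r x ≤ n) → ¬ marked r →
        0 < δ → δ < 1 →
        ((∃ x, marked x) →
          TreeWalk.outputProb (TreeWalk.opRA G r marked n) (TreeWalk.opRB G r marked n)
              r β γ T n δ false ≤ δ ∧
          1 - δ ≤ TreeWalk.outputProb (TreeWalk.opRA G r marked n) (TreeWalk.opRB G r marked n)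
              r β γ T n δ true) ∧
        ((¬ ∃ x, marked x) →
          TreeWalk.outputProb (TreeWalk.opRA G r marked n) (TreeWalk.opRB G r marked n)
              r β γ T n δ true ≤ δ ∧
          1 - δ ≤ TreeWalk.outputProb (TreeWalk.opRA G r marked n) (TreeWalk.opRB G r marked n)
              r β γ T n δ false)) := by
  refine ⟨fun β γ hβ hγ => ⟨2 * (1 + 1 / β) * (γ + 2), by positivity, ?_⟩,
    1 / 2, 50, by norm_num, by norm_num, ?_⟩
  · intro T n hT hn δ hδ hδ1
    obtain ⟨h1, h2⟩ := TreeWalk.uses_le hβ hγ hT hn hδ hδ1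
    rw [TreeWalk.detectUsesRA, TreeWalk.detectUsesRB, TreeWalk.usesRA_phaseEstimation,
      TreeWalk.usesRB_phaseEstimation]
    exact ⟨h1, h1, fun h => ⟨h2 h, h2 h⟩⟩
  · intro V _ G r marked T n δ hG hT hn hd hr hδ _
    classical
    have hA : (TreeWalk.opRA G r marked n).conjTranspose * TreeWalk.opRA G r marked n = 1 := by
      rw [(TreeWalk.opRA_isHermitian hG).eq, TreeWalk.opRA_sq hG]
    have hB : (TreeWalk.opRB G r marked n).conjTranspose * TreeWalk.opRB G r marked n = 1 := by
      rw [(TreeWalk.opRB_isHermitian hG).eq, TreeWalk.opRB_sq hG]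
    -- The two outputs have total probability one, so bounding the wrong one also bounds the right
    -- one from below.
    have hsum := TreeWalk.outputProb_false_add_true (T := T) (n := n) (δ := δ) (r := r)
      hA hB (1 / 2) 50
    constructor
    · intro hm
      have h := TreeWalk.outputProb_false_le (T := T) (n := n) hA hB (β := 1 / 2) hδ
        (TreeWalk.half_le_runProb_of_marked hG hn hd hr hm _)
      exact ⟨h, by linarith⟩
    · intro hm
      have h := TreeWalk.outputProb_true_le (T := T) (n := n) hA hB (β := 1 / 2) hδ
        (TreeWalk.runProb_le_of_unmarked hG hT hn hm)
      exact ⟨h, by linarith⟩
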